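/- For a subgroup $H$ of a group $T$, let $N_T(H)=\{g\in T : gHg^{-1}=H\}$ be its normaliser. A group $T$ is called *freely telescopic* if for every finite group $\Gamma$ there is a subgroup $H\le T$ of finite index that is a free group (the trivial group counts as free, of rank $0$) and satisfies $N_T(H)/H\cong\Gamma$. **Proposition.** Let $G_1$ be a freely telescopic group and let $G_2$ be a group that has a free subgroup $H$ of finite index with $N_{G_2}(H)=H$. Then the free product $G_1*G_2$ is freely telescopic. In particular, the free product of two freely telescopic groups is freely telescopic. -/

import Mathlib

/-- A group `T` is freely telescopic if every finite group `Γ` is isomorphic to `N_T(H) / H` for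
some free subgroup `H` of finite index in `T`. Here `H.subgroupOf (Subgroup.normalizer H)` is `H`
viewed as a (normal) subgroup of its normaliser. Every finite group is isomorphic to one whose
underlying set lives in `Type`, so letting `Γ` range over `Type` loses nothing. -/
def IsFreelyTelescopic (T : Type*) [Group T] : Prop :=
  ∀ (Γ : Type) [Group Γ] [Finite Γ],
    ∃ H : Subgroup T, H.FiniteIndex ∧ IsFreeGroup H ∧
      Nonempty ((Subgroup.normalizer (H : Set T) ⧸
        H.subgroupOf (Subgroup.normalizer (H : Set T))) ≃* Γ)

open CategoryTheory

universe u v w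

/-! Let `H₁` realise `Γ` in `G₁`, let `H₂` be free, of finite index and self-normalising in `G₂`,
and pull `H₁ × H₂` back along the surjection `G₁ ∗ G₂ → G₁ × G₂`. The index stays finite, and the
normaliser is the preimage of `N(H₁) × H₂`, so the quotient is `N(H₁)/H₁ ≅ Γ`. Freeness: the
pullback is a point stabiliser for the transitive action on `G₁/H₁ × G₂/H₂`. Restricted to either
factor, this action is a disjoint union of copies of `Gᵢ/Hᵢ`, whose action groupoid is free because
`Hᵢ` is. The universal property of `∗` glues the two free groupoids along their common objects into
a free one, and the vertex groups of a connected free groupoid are free. -/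

/-- A `1`-cocycle of a permutation action `ρ` of `G` on `X` with values in `A`, i.e. a functor from
the action groupoid to `A`. -/
def IsActionCocycle {G X A : Type*} [Group G] [Group A] (ρ : G →* Equiv.Perm X)
    (c : G → X → A) : Prop :=
  ∀ g h x, c (g * h) x = c g (ρ h x) * c h x

namespace IsActionCocycle

variable {G X A : Type*} [Group G] [Group A] {ρ : G →* Equiv.Perm X} {c : G → X → A}

lemma map_one (hc : IsActionCocycle ρ c) (x : X) : c 1 x = 1 := by
  have := hc 1 1 x
  simpa using this

/-- The permutation action on `X × A` determined by a cocycle. -/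
def skewProduct (hc : IsActionCocycle ρ c) : G →* Equiv.Perm (X × A) :=
  MonoidHom.toHomPerm
    { toFun := fun g p => (ρ g p.1, c g p.1 * p.2)
      map_one' := by
        funext p
        simp [hc.map_one, Function.End.one_def]
      map_mul' := fun g h => by
        funext p
        change _ = (ρ g (ρ h p.1), c g (ρ h p.1) * (c h p.1 * p.2))
        simp [hc g h, mul_assoc] }

@[simp]
lemma skewProduct_apply (hc : IsActionCocycle ρ c) (g : G) (p : X × A) :
    hc.skewProduct g p = (ρ g p.1, c g p.1 * p.2) := rfl

end IsActionCocycle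

/-- The arrows `elt e : src e ⟶ elt e • src e` form a free generating family of the action groupoid
of `ρ`: cocycles with values in a group correspond to arbitrary labellings of these arrows. -/
def FreelyGeneratesAction {G X E : Type*} [Group G] (ρ : G →* Equiv.Perm X)
    (src : E → X) (elt : E → G) : Prop :=
  ∀ (A : Type w) [Group A] (f : E → A),
    ∃! c : G → X → A, IsActionCocycle ρ c ∧ ∀ e, c (elt e) (src e) = f e

/-! ### Free generation of action groupoids -/

namespace FreelyGeneratesAction

/-- The groupoid of `G` acting on `G ⧸ H` is freely generated by a basis of `H` together with a star
of arrows from the base point to the other points. -/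
lemma quotient {G ι : Type*} [Group G] (H : Subgroup G) (b : FreeGroupBasis ι H) :
    FreelyGeneratesAction.{w} (MulAction.toPermHom G (G ⧸ H))
      (fun _ : ι ⊕ {x : G ⧸ H // x ≠ ((1 : G) : G ⧸ H)} => ((1 : G) : G ⧸ H))
      (Sum.elim (fun i => (b i : G)) (fun x => x.1.out)) := by
  classical
  intro A _ f
  -- The representative of the base coset is forced to be `1`, which `Quotient.out` does not
  -- guarantee: the star has no arrow there.
  let r : G ⧸ H → G := fun x => if x = ((1 : G) : G ⧸ H) then 1 else x.out
  have hr : ∀ x, (r x : G ⧸ H) = x := by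
    intro x
    by_cases hx : x = ((1 : G) : G ⧸ H)
    · simp [r, hx]
    · simp [r, hx]
  have hr' : ∀ x, r x • ((1 : G) : G ⧸ H) = x := fun x => by
    rw [MulAction.Quotient.smul_coe, smul_eq_mul, mul_one, hr]
  have hmem : ∀ g x, (r (g • x))⁻¹ * (g * r x) ∈ H := by
    intro g x
    rw [← QuotientGroup.eq, hr, ← smul_eq_mul g, ← MulAction.Quotient.smul_coe, hr]
  let a : G ⧸ H → A := fun x =>
    if hx : x = ((1 : G) : G ⧸ H) then 1 else f (Sum.inr ⟨x, hx⟩)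
  let φ : H →* A := b.lift (fun i => f (Sum.inl i))
  have ha1 : a ((1 : G) : G ⧸ H) = 1 := by simp [a]
  have hr1 : r ((1 : G) : G ⧸ H) = 1 := by simp [r]
  -- `d g x` is the loop at the base point: out to `x` along the star, across by `g`, and back from
  -- `g • x`.
  obtain ⟨d, hd⟩ : ∃ d : G → G ⧸ H → H, ∀ g x, (d g x : G) = (r (g • x))⁻¹ * (g * r x) :=
    ⟨fun g x => ⟨_, hmem g x⟩, fun _ _ => rfl⟩
  refine ⟨fun g x => a (g • x) * φ (d g x) * (a x)⁻¹, ⟨?_, ?_⟩, ?_⟩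
  · intro g h x
    have : d (g * h) x = d g (h • x) * d h x := by
      ext
      simp [hd, mul_smul, mul_assoc]
    simp only [this, map_mul, MulAction.toPermHom_apply, MulAction.toPerm_apply, mul_smul]
    group
  · rintro (i | ⟨x, hx⟩)
    · have h1 : (b i : G) • ((1 : G) : G ⧸ H) = ((1 : G) : G ⧸ H) := by
        rw [MulAction.Quotient.smul_coe, smul_eq_mul, mul_one, QuotientGroup.eq]
        simp
      have h2 : d (b i) ((1 : G) : G ⧸ H) = b i := by
        ext
        simp only [hd, h1, hr1]
        simp
      simp only [Sum.elim_inl, h2, h1, ha1]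
      simp [φ]
    · have h0 : r x = x.out := by simp [r, hx]
      have h1 : x.out • ((1 : G) : G ⧸ H) = x := h0 ▸ hr' x
      have h2 : d x.out ((1 : G) : G ⧸ H) = 1 := by
        ext
        simp only [hd, h1, hr1, h0]
        simp
      simp only [Sum.elim_inr, h2, h1, ha1]
      simp [a, hx]
  · rintro c ⟨hc, hf⟩
    have hca : ∀ x, c (r x) ((1 : G) : G ⧸ H) = a x := by
      intro x
      by_cases hx : x = ((1 : G) : G ⧸ H)
      · rw [hx, hr1, ha1, hc.map_one]
      · have := hf (Sum.inr ⟨x, hx⟩)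
        simpa [r, a, hx] using this
    have hfix : ∀ h : H, (h : G) • ((1 : G) : G ⧸ H) = ((1 : G) : G ⧸ H) := fun h => by
      rw [MulAction.Quotient.smul_coe, smul_eq_mul, mul_one, QuotientGroup.eq]
      simp
    let ψ : H →* A :=
      { toFun := fun h => c h ((1 : G) : G ⧸ H)
        map_one' := hc.map_one _
        map_mul' := fun h k => by
          have := hc h k ((1 : G) : G ⧸ H)
          rwa [MulAction.toPermHom_apply, MulAction.toPerm_apply, hfix] at this }
    have hψ : ψ = φ := b.ext_hom _ _ fun i => by
      have := hf (Sum.inl i)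
      simpa [φ, ψ] using this
    have hcφ : ∀ h : H, c h ((1 : G) : G ⧸ H) = φ h := fun h => DFunLike.congr_fun hψ h
    funext g x
    rw [eq_mul_inv_iff_mul_eq, ← hca, ← hca, ← hcφ, hd]
    -- Uniqueness: expand `c (g * r x)` at the base point in two ways, through `x` and through the
    -- loop `d g x`.
    have e1 := hc g (r x) ((1 : G) : G ⧸ H)
    have e2 := hc (r (g • x)) ((r (g • x))⁻¹ * (g * r x)) ((1 : G) : G ⧸ H)
    rw [MulAction.toPermHom_apply, MulAction.toPerm_apply] at e1 e2
    rw [hr'] at e1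
    rw [hfix ⟨_, hmem g x⟩, mul_inv_cancel_left] at e2
    rw [← e1, e2]

/-- A disjoint union of copies of an action has the disjoint union of the generating families. -/
lemma prod {G X Y Z E : Type*} [Group G] {ρ : G →* Equiv.Perm X} {src : E → X} {elt : E → G}
    (h : FreelyGeneratesAction.{w} ρ src elt) (ρ' : G →* Equiv.Perm Z) (e : X × Y ≃ Z)
    (he : ∀ g x y, ρ' g (e (x, y)) = e (ρ g x, y)) :
    FreelyGeneratesAction.{w} ρ' (fun p : E × Y => e (src p.1, p.2)) (fun p => elt p.1) := by
  intro A _ f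
  choose c hc huniq using fun y => h A fun i => f (i, y)
  refine ⟨fun g z => c (e.symm z).2 g (e.symm z).1, ⟨?_, ?_⟩, ?_⟩
  · intro g k z
    obtain ⟨⟨x, y⟩, rfl⟩ := e.surjective z
    simpa [he] using (hc y).1 g k x
  · rintro ⟨i, y⟩
    simpa using (hc y).2 i
  · rintro c' ⟨hc', hf⟩
    funext g z
    obtain ⟨⟨x, y⟩, rfl⟩ := e.surjective z
    have := huniq y (fun g x => c' g (e (x, y)))
      ⟨fun g k x => by simpa [he] using hc' g k (e (x, y)), fun i => hf (i, y)⟩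
    simpa using congrFun (congrFun this g) x

/-- An action of a free product is freely generated by the generators of its restrictions. -/
lemma coprod {G₁ G₂ X E₁ E₂ : Type*} [Group G₁] [Group G₂]
    {ρ : Monoid.Coprod G₁ G₂ →* Equiv.Perm X}
    {src₁ : E₁ → X} {elt₁ : E₁ → G₁} {src₂ : E₂ → X} {elt₂ : E₂ → G₂}
    (h₁ : FreelyGeneratesAction.{w} (ρ.comp Monoid.Coprod.inl) src₁ elt₁)
    (h₂ : FreelyGeneratesAction.{w} (ρ.comp Monoid.Coprod.inr) src₂ elt₂) :
    FreelyGeneratesAction.{w} ρ (Sum.elim src₁ src₂)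
      (Sum.elim (fun e => Monoid.Coprod.inl (elt₁ e)) (fun e => Monoid.Coprod.inr (elt₂ e))) := by
  intro A _ f
  obtain ⟨c₁, ⟨hc₁, hf₁⟩, hu₁⟩ := h₁ A fun e => f (Sum.inl e)
  obtain ⟨c₂, ⟨hc₂, hf₂⟩, hu₂⟩ := h₂ A fun e => f (Sum.inr e)
  -- Cocycles need not extend multiplicatively, but their skew-product actions on `X × A` are
  -- homomorphisms and so can be glued; the cocycle is then read off at `(x, 1)`.
  let σ := Monoid.Coprod.lift hc₁.skewProduct hc₂.skewProduct
  let c : Monoid.Coprod G₁ G₂ → X → A := fun t x => (σ t (x, 1)).2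
  have hσ : ∀ t p, σ t p = (ρ t p.1, c t p.1 * p.2) := by
    intro t
    induction t using Monoid.Coprod.induction_on with
    | inl g => intro p; simp [σ, c]
    | inr g => intro p; simp [σ, c]
    | mul s t hs ht =>
      intro p
      have hst : ∀ q, σ (s * t) q = σ s (σ t q) := fun q => by simp
      rw [hst, ht, hs]
      have hcst : c (s * t) p.1 = c s (ρ t p.1) * c t p.1 := by
        change (σ (s * t) (p.1, 1)).2 = _
        rw [hst, ht, hs]
        simp
      simp [hcst, mul_assoc]
  have hc₁' : ∀ g x, c (Monoid.Coprod.inl g) x = c₁ g x := fun g x => by simp [c, σ]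
  have hc₂' : ∀ g x, c (Monoid.Coprod.inr g) x = c₂ g x := fun g x => by simp [c, σ]
  refine ⟨c, ⟨?_, ?_⟩, ?_⟩
  · intro s t x
    change (σ (s * t) (x, 1)).2 = _
    rw [map_mul, Equiv.Perm.mul_apply, hσ t, hσ s]
    simp
  · rintro (e | e)
    · simpa [hc₁'] using hf₁ e
    · simpa [hc₂'] using hf₂ e
  · rintro d ⟨hd, hf⟩
    have d₁ := hu₁ (fun g x => d (Monoid.Coprod.inl g) x)
      ⟨fun g k x => by simpa using hd (Monoid.Coprod.inl g) (Monoid.Coprod.inl k) x,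
        fun e => hf (Sum.inl e)⟩
    have d₂ := hu₂ (fun g x => d (Monoid.Coprod.inr g) x)
      ⟨fun g k x => by simpa using hd (Monoid.Coprod.inr g) (Monoid.Coprod.inr k) x,
        fun e => hf (Sum.inr e)⟩
    funext t
    induction t using Monoid.Coprod.induction_on with
    | inl g => funext x; rw [hc₁']; exact congrFun (congrFun d₁ g) x
    | inr g => funext x; rw [hc₂']; exact congrFun (congrFun d₂ g) x
    | mul s t hs ht =>
      funext x
      rw [hd, hs, ht]
      change _ = (σ (s * t) (x, 1)).2
      rw [map_mul, Equiv.Perm.mul_apply, hσ t, hσ s]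
      simp

/-! ### Passage to free groupoids and stabilisers -/

/-- A generating family of an action makes its action groupoid a free groupoid. -/
@[reducible]
def isFreeGroupoid {G X E : Type u} [Group G] [MulAction G X] {src : E → X} {elt : E → G}
    (h : FreelyGeneratesAction.{u} (MulAction.toPermHom G X) src elt) :
    IsFreeGroupoid (ActionCategory G X) where
  quiverGenerators :=
    ⟨fun a b => {e : E // src e = a.back ∧ elt e • a.back = b.back}⟩
  of := fun e => ⟨elt e.1, e.2.2⟩
  unique_lift := by
    intro A _ f
    obtain ⟨c, ⟨hc, hf⟩, hu⟩ := h A fun e =>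
      @f ⟨(), src e⟩ ⟨(), elt e • src e⟩ ⟨e, rfl, rfl⟩
    refine ⟨{ obj := fun _ => ()
              map := fun {a b} g => c g.val a.back
              map_id := ?_
              map_comp := ?_ }, ?_, ?_⟩
    · intro a
      exact hc.map_one _
    · rintro ⟨⟨⟩, (x : X)⟩ ⟨⟨⟩, (y : X)⟩ ⟨⟨⟩, z⟩ ⟨(g : G), hg⟩ ⟨k, hk⟩
      obtain rfl : g • x = y := hg
      exact hc k g x
    · rintro ⟨⟨⟩, x⟩ ⟨⟨⟩, y⟩ ⟨e, h1, h2⟩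
      obtain rfl : src e = x := h1
      obtain rfl : elt e • src e = y := h2
      exact hf e
    · intro F hF
      have hFc := hu (fun g x =>
          F.map (X := (⟨(), x⟩ : ActionCategory G X)) (Y := (⟨(), g • x⟩ : ActionCategory G X))
            ⟨g, rfl⟩) ⟨?_, ?_⟩
      · refine Functor.hext (fun _ => rfl) ?_
        rintro ⟨⟨⟩, (x : X)⟩ ⟨⟨⟩, (y : X)⟩ ⟨(g : G), hg⟩
        obtain rfl : g • x = y := hg
        exact heq_of_eq (congrFun (congrFun hFc g) x)
      · intro g k x
        have hcomp := F.map_comp (X := (⟨(), x⟩ : ActionCategory G X))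
          (Y := (⟨(), k • x⟩ : ActionCategory G X)) (Z := (⟨(), g • k • x⟩ : ActionCategory G X))
          ⟨k, rfl⟩ ⟨g, rfl⟩
        refine Eq.trans ?_ hcomp
        -- The targets `(g * k) • x` and `g • k • x` are equal only propositionally, so the target
        -- is generalised.
        have : ∀ (y : X) (h : (g * k) • x = y),
            (F.map (X := (⟨(), x⟩ : ActionCategory G X))
              (Y := (⟨(), (g * k) • x⟩ : ActionCategory G X)) ⟨g * k, rfl⟩ : A) =
            F.map (X := (⟨(), x⟩ : ActionCategory G X))
              (Y := (⟨(), y⟩ : ActionCategory G X)) ⟨g * k, h⟩ := by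
          rintro _ rfl
          rfl
        exact this _ (mul_smul g k x)
      · intro e
        exact hF ⟨(), src e⟩ ⟨(), elt e • src e⟩ ⟨e, rfl, rfl⟩

/-- Point stabilisers of a transitive action with a free generating family are free groups. -/
lemma isFreeGroup_stabilizer {G X E : Type u} [Group G] [MulAction G X]
    [MulAction.IsPretransitive G X] {src : E → X} {elt : E → G}
    (h : FreelyGeneratesAction.{u} (MulAction.toPermHom G X) src elt) (x : X) :
    IsFreeGroup (MulAction.stabilizer G x) := by
  let := h.isFreeGroupoid
  have : Nonempty X := ⟨x⟩
  have hconn : @IsConnected (ActionCategory G X) Groupoid.toCategory :=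
    zigzag_isConnected fun a b => Relation.ReflTransGen.single <| Or.inl <|
      nonempty_subtype.mpr (MulAction.exists_smul_eq G a.back b.back)
  have hfree := IsFreeGroupoid.endIsFreeOfConnectedFree (ActionCategory.objEquiv G X x)
  refine @IsFreeGroup.ofMulEquiv _ _ hfree _ _ ?_
  exact
    { toFun := fun f => ⟨f.1, f.2⟩
      invFun := fun g => ⟨g.1, g.2⟩
      left_inv := fun _ => rfl
      right_inv := fun _ => rfl
      map_mul' := fun _ _ => rfl }

end FreelyGeneratesAction

namespace Monoid.Coprod

variable {G₁ : Type u} {G₂ : Type v} [Group G₁] [Group G₂]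

/-- The free product acts on a product of sets through the two projections. -/
@[reducible]
def prodMulAction (X : Type*) (Y : Type*) [MulAction G₁ X] [MulAction G₂ Y] :
    MulAction (Monoid.Coprod G₁ G₂) (X × Y) where
  smul t p := (fst t • p.1, snd t • p.2)
  one_smul p := by
    change (fst (1 : Monoid.Coprod G₁ G₂) • p.1, snd (1 : Monoid.Coprod G₁ G₂) • p.2) = p
    simp
  mul_smul s t p := by
    change (fst (s * t) • p.1, snd (s * t) • p.2) = (fst s • fst t • p.1, snd s • snd t • p.2)
    simp [mul_smul]

/-- The preimage of a product of free subgroups under `G₁ ∗ G₂ → G₁ × G₂` is free: a special case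
of the Kurosh subgroup theorem. -/
lemma isFreeGroup_comap_toProd {H₁ : Subgroup G₁} {H₂ : Subgroup G₂}
    (h₁ : IsFreeGroup H₁) (h₂ : IsFreeGroup H₂) :
    IsFreeGroup ((H₁.prod H₂).comap (toProd : Monoid.Coprod G₁ G₂ →* G₁ × G₂)) := by
  let : MulAction (Monoid.Coprod G₁ G₂) ((G₁ ⧸ H₁) × (G₂ ⧸ H₂)) := prodMulAction _ _
  have smul_def : ∀ (t : Monoid.Coprod G₁ G₂) (p : (G₁ ⧸ H₁) × (G₂ ⧸ H₂)),
    t • p = (fst t • p.1, snd t • p.2) := fun _ _ => rfl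
  have : MulAction.IsPretransitive (Monoid.Coprod G₁ G₂) ((G₁ ⧸ H₁) × (G₂ ⧸ H₂)) := by
    refine ⟨fun p q => ?_⟩
    obtain ⟨g, hg⟩ := MulAction.exists_smul_eq G₁ p.1 q.1
    obtain ⟨k, hk⟩ := MulAction.exists_smul_eq G₂ p.2 q.2
    refine ⟨inl g * inr k, ?_⟩
    simp [smul_def, hg, hk]
  have f₁ := (FreelyGeneratesAction.quotient.{max u v} H₁ (IsFreeGroup.basis H₁)).prod
    ((MulAction.toPermHom (Monoid.Coprod G₁ G₂) ((G₁ ⧸ H₁) × (G₂ ⧸ H₂))).comp inl)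
    (Equiv.refl _) (fun g x y => by simp [smul_def])
  have f₂ := (FreelyGeneratesAction.quotient.{max u v} H₂ (IsFreeGroup.basis H₂)).prod
    ((MulAction.toPermHom (Monoid.Coprod G₁ G₂) ((G₁ ⧸ H₁) × (G₂ ⧸ H₂))).comp inr)
    (Equiv.prodComm _ _) (fun g x y => by simp [smul_def])
  have key := (f₁.coprod f₂).isFreeGroup_stabilizer (((1 : G₁) : G₁ ⧸ H₁), ((1 : G₂) : G₂ ⧸ H₂))
  have hstab : (H₁.prod H₂).comap (toProd : Monoid.Coprod G₁ G₂ →* G₁ × G₂) =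
      MulAction.stabilizer (Monoid.Coprod G₁ G₂)
        (((1 : G₁) : G₁ ⧸ H₁), ((1 : G₂) : G₂ ⧸ H₂)) := by
    ext t
    have m₁ : fst t • ((1 : G₁) : G₁ ⧸ H₁) = ((1 : G₁) : G₁ ⧸ H₁) ↔ fst t ∈ H₁ := by
      rw [← MulAction.mem_stabilizer_iff, MulAction.stabilizer_quotient]
    have m₂ : snd t • ((1 : G₂) : G₂ ⧸ H₂) = ((1 : G₂) : G₂ ⧸ H₂) ↔ snd t ∈ H₂ := by
      rw [← MulAction.mem_stabilizer_iff, MulAction.stabilizer_quotient]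
    rw [Subgroup.mem_comap, Subgroup.mem_prod, fst_toProd, snd_toProd,
      MulAction.mem_stabilizer_iff, smul_def, Prod.mk.injEq, m₁, m₂]
  rw [hstab]
  exact key

end Monoid.Coprod

/-! ### Normalisers and the conclusion -/

lemma Subgroup.normalizer_prod {G₁ G₂ : Type*} [Group G₁] [Group G₂]
    (H₁ : Subgroup G₁) (H₂ : Subgroup G₂) :
    Subgroup.normalizer ((H₁.prod H₂ : Subgroup (G₁ × G₂)) : Set (G₁ × G₂)) =
      (Subgroup.normalizer (H₁ : Set G₁)).prod (Subgroup.normalizer (H₂ : Set G₂)) := by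
  ext ⟨g, k⟩
  simp only [Subgroup.mem_prod, Subgroup.mem_normalizer_iff, Prod.forall,
    Prod.mk_mul_mk, Prod.inv_mk]
  constructor
  · intro h
    exact ⟨fun a => by simpa [H₂.one_mem] using h a 1, fun b => by simpa [H₁.one_mem] using h 1 b⟩
  · rintro ⟨h₁, h₂⟩ a b
    exact and_congr (h₁ a) (h₂ b)

/-- If `H₂` is self-normalising, the preimage of `H₁ × H₂` in the free product has the same
normaliser quotient as `H₁`. -/
lemma Monoid.Coprod.nonempty_normalizer_quotient_mulEquiv {G₁ G₂ : Type*} [Group G₁] [Group G₂]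
    (H₁ : Subgroup G₁) {H₂ : Subgroup G₂} (hN : Subgroup.normalizer (H₂ : Set G₂) = H₂)
    {H : Subgroup (Monoid.Coprod G₁ G₂)}
    (hH : H = (H₁.prod H₂).comap Monoid.Coprod.toProd) :
    Nonempty ((Subgroup.normalizer (H : Set (Monoid.Coprod G₁ G₂)) ⧸
        H.subgroupOf (Subgroup.normalizer (H : Set (Monoid.Coprod G₁ G₂)))) ≃*
      (Subgroup.normalizer (H₁ : Set G₁) ⧸ H₁.subgroupOf (Subgroup.normalizer (H₁ : Set G₁)))) := by
  have hmem : ∀ t, t ∈ Subgroup.normalizer (H : Set (Monoid.Coprod G₁ G₂)) ↔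
      fst t ∈ Subgroup.normalizer (H₁ : Set G₁) ∧ snd t ∈ H₂ := by
    intro t
    have hsurj : Function.Surjective (toProd : Monoid.Coprod G₁ G₂ →* G₁ × G₂) :=
      toProd_surjective
    rw [hH, ← Subgroup.comap_normalizer_eq_of_surjective _ hsurj,
      Subgroup.normalizer_prod, hN, Subgroup.mem_comap, Subgroup.mem_prod, fst_toProd, snd_toProd]
  let π : Subgroup.normalizer (H : Set (Monoid.Coprod G₁ G₂)) →*
      Subgroup.normalizer (H₁ : Set G₁) :=
    (fst.comp (Subgroup.subtype _)).codRestrict _ fun t => ((hmem t.1).1 t.2).1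
  let φ := (QuotientGroup.mk' (H₁.subgroupOf (Subgroup.normalizer (H₁ : Set G₁)))).comp π
  have hφ : Function.Surjective φ := by
    refine (QuotientGroup.mk'_surjective _).comp fun g => ?_
    exact ⟨⟨inl g.1, (hmem _).2 (by simp [H₂.one_mem])⟩, Subtype.ext (fst_apply_inl (N := G₂) g.1)⟩
  have hker : H.subgroupOf (Subgroup.normalizer (H : Set (Monoid.Coprod G₁ G₂))) = φ.ker := by
    ext t
    have ht := ((hmem t).1 t.2).2
    simp only [φ, MonoidHom.mem_ker, MonoidHom.comp_apply, QuotientGroup.mk'_apply,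
      QuotientGroup.eq_one_iff, Subgroup.mem_subgroupOf]
    rw [show ((π t : Subgroup.normalizer (H₁ : Set G₁)) : G₁) = fst t.1 from rfl]
    have hmemH : t.1 ∈ H ↔ fst t.1 ∈ H₁ ∧ snd t.1 ∈ H₂ := by
      generalize t.1 = x
      rw [hH, Subgroup.mem_comap, Subgroup.mem_prod, fst_toProd, snd_toProd]
    exact hmemH.trans (and_iff_left ht)
  exact ⟨(QuotientGroup.quotientMulEquivOfEq hker).trans
    (QuotientGroup.quotientKerEquivOfSurjective φ hφ)⟩

lemma IsFreelyTelescopic.coprod {G₁ G₂ : Type*} [Group G₁] [Group G₂]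
    (h₁ : IsFreelyTelescopic G₁) {H₂ : Subgroup G₂} (hfin : H₂.FiniteIndex)
    (hfree : IsFreeGroup H₂) (hN : Subgroup.normalizer (H₂ : Set G₂) = H₂) :
    IsFreelyTelescopic (Monoid.Coprod G₁ G₂) := by
  intro Γ _ _
  obtain ⟨H₁, hfin₁, hfree₁, ⟨e⟩⟩ := h₁ Γ
  refine ⟨(H₁.prod H₂).comap Monoid.Coprod.toProd, ⟨?_⟩,
    Monoid.Coprod.isFreeGroup_comap_toProd hfree₁ hfree, ?_⟩
  · have hsurj : Function.Surjective (Monoid.Coprod.toProd : Monoid.Coprod G₁ G₂ →* G₁ × G₂) :=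
      Monoid.Coprod.toProd_surjective
    rw [Subgroup.index_comap_of_surjective _ hsurj, Subgroup.index_prod]
    exact mul_ne_zero hfin₁.index_ne_zero hfin.index_ne_zero
  obtain ⟨e'⟩ := Monoid.Coprod.nonempty_normalizer_quotient_mulEquiv H₁ hN rfl
  exact ⟨e'.trans e⟩

/-- Realising the trivial group forces `N(H)/H` to be trivial; this reduces the second claim to the
first. -/
lemma IsFreelyTelescopic.exists_normalizer_eq_self {G : Type*} [Group G]
    (h : IsFreelyTelescopic G) :
    ∃ H : Subgroup G, H.FiniteIndex ∧ IsFreeGroup H ∧ Subgroup.normalizer (H : Set G) = H := by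
  obtain ⟨H, hfin, hfree, ⟨e⟩⟩ := h Unit
  refine ⟨H, hfin, hfree, le_antisymm (fun g hg => ?_) Subgroup.le_normalizer⟩
  have := e.injective (Subsingleton.elim (e ((⟨g, hg⟩ : Subgroup.normalizer (H : Set G)))) (e 1))
  rwa [QuotientGroup.eq_one_iff, Subgroup.mem_subgroupOf] at this

theorem mainTheorem10 {G₁ G₂ : Type*} [Group G₁] [Group G₂]
    (h₁ : IsFreelyTelescopic G₁) :
    ((∃ H : Subgroup G₂, H.FiniteIndex ∧ IsFreeGroup H ∧
        Subgroup.normalizer (H : Set G₂) = H) →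
      IsFreelyTelescopic (Monoid.Coprod G₁ G₂)) ∧
    (IsFreelyTelescopic G₂ → IsFreelyTelescopic (Monoid.Coprod G₁ G₂)) := by
  have key : (∃ H : Subgroup G₂, H.FiniteIndex ∧ IsFreeGroup H ∧
      Subgroup.normalizer (H : Set G₂) = H) → IsFreelyTelescopic (Monoid.Coprod G₁ G₂) :=
    fun ⟨_, hfin, hfree, hN⟩ => h₁.coprod hfin hfree hN
  exact ⟨key, fun h₂ => key h₂.exists_normalizer_eq_self⟩
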